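/- Let $n\ge 2$ and $m\ge 2$. An $n$-player, $m$-strategy game is given by payoff functions $u_1,\dots,u_n : \{1,\dots,m\}^n\to\mathbb{R}$; its $n\,m^n$ payoffs $u_i(s)$ are drawn independently from the standard normal distribution. A strategy profile $s$ is a pure strategy Nash equilibrium (PSNE) if $u_i(s)\ge u_i(s_i',s_{-i})$ for every player $i$ and every strategy $s_i'$. In the clockwork best-response dynamic the players move one at a time in the cyclic order $1,2,\dots,n,1,2,\dots$, starting with player $1$ from an arbitrary initial profile; the player whose turn it is switches to a best response, i.e. a strategy maximizing their payoff against the current strategies of the others. The game is convergent if, from every initial profile, after sufficiently many turns no player changes their strategy any more. Let $p^1_{n,m}$ denote the probability that the game is convergent and has exactly one PSNE. Then $$p^1_{n,m} = r^{n-1} + \frac{m-1}{m-r}\left(\left(\frac{r}{m}\right)^{n-1}-1\right),\qquad\text{where } r := \frac{m-1}{m^n}+1.$$ For instance, $p^1_{2,m} = \frac{2m-1}{m^2} = \frac1m\left(2-\frac1m\right)$. -/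

import Mathlib

open MeasureTheory ProbabilityTheory

/-- An `n`-player, `m`-strategy game in normal form: `u i s` is the payoff of player `i` under
the strategy profile `s`. -/
abbrev Game (n m : ℕ) : Type := Fin n → (Fin n → Fin m) → ℝ

/-- The set `argmax_a u i (a, s_{-i})` of best responses of player `i` to the environment
`s_{-i}`. The environment is given as a full profile `s`, whose `i`-th coordinate is ignored. -/
def bestResponses {n m : ℕ} (u : Game n m) (i : Fin n) (s : Fin n → Fin m) : Set (Fin m) :=
  {a | ∀ b : Fin m, u i (Function.update s i b) ≤ u i (Function.update s i a)}

/-- The profile `s` is a pure strategy Nash equilibrium. -/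
def IsPSNE {n m : ℕ} (u : Game n m) (s : Fin n → Fin m) : Prop :=
  ∀ (i : Fin n) (a : Fin m), u i (Function.update s i a) ≤ u i s

/-- The sequence of profiles `s 0, s 1, s 2, …` is a play of the clockwork best-response dynamic:
in turn `t` the player `t mod n` (players are numbered `0, …, n - 1`) switches to a best response,
and all the other players keep their strategies. The initial profile `s 0` is arbitrary. -/
def IsClockworkPlay {n m : ℕ} (u : Game n m) (s : ℕ → Fin n → Fin m) : Prop :=
  ∀ (t : ℕ) (i : Fin n), (i : ℕ) = t % n →
    ∃ a ∈ bestResponses u i (s t), s (t + 1) = Function.update (s t) i a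

/-- A game is convergent if in every play of the clockwork best-response dynamic, after
sufficiently many turns, no player changes their strategy any more. -/
def IsConvergent {n m : ℕ} (u : Game n m) : Prop :=
  ∀ s : ℕ → Fin n → Fin m, IsClockworkPlay u s → ∃ T : ℕ, ∀ t ≥ T, s (t + 1) = s t

/-- The law of a random game, whose `n * m ^ n` payoffs are i.i.d. standard normal. -/
noncomputable def randomGame (n m : ℕ) : Measure (Game n m) :=
  Measure.pi fun _ : Fin n => Measure.pi fun _ : Fin n → Fin m => gaussianReal 0 1

/-- `p^k_{n,m}`: the probability that a random game is convergent and has exactly `k` pure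
strategy Nash equilibria. -/
noncomputable def convergentFrequency (k n m : ℕ) : ℝ :=
  (randomGame n m).real {u | IsConvergent u ∧ {s | IsPSNE u s}.ncard = k}

/-!
Almost surely no two payoffs of a player agree, so every player has a unique best response in every
environment, and swapping payoffs shows that these best responses are independent and uniform. A
decision node is a pair of a player about to move and the strategies of the others. The clockwork
dynamic is then a random map on decision nodes, which sends each node to one of `m` possible
successors. A game is convergent with `c` as its only equilibrium exactly when this map fixes the
profile `c` and every node is eventually led to `c` (`Node.isConvergent_of_absorbs`,
`Node.absorbs_of_isConvergent`).

The number of such maps is a determinant, as in the matrix-tree theorem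
(`card_absorbing_choices_eq_det`). Let `T` be the uniform random walk on nodes killed at `c`, and
multiply all rows of `1 - T` by `m` except those of the `n` nodes of `c`. Expanding the determinant
by multilinearity in the rows gives one term for each choice of successors, equal to `1` if `c` is
fixed and all nodes are led to `c`, and to `0` otherwise. Consequently the probability of
convergence with unique equilibrium `c` is `m⁻ⁿ det (1 - T)`.

For the walk only the number of most recent movers who agree with `c` matters, and this number drops
to `0` whenever a player deviates from `c`. Write `T = N + A B`, where `A B`, of rank `n`,
replaces the node after a deviation by one fixed node per player. The remainder `N` is
nilpotent (`Node.excursion_isNilpotent`), since after `n - 1` turns the initial environment is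
forgotten, except for its run of agreements. Hence
`det (1 - T) = det (1 - B (1 - N)⁻¹ A) = det (1 - K)`, where, with `q = 1 / m`, the `n × n`
circulant matrix `K` has the entry `(1 - q) q ^ (k - 1)` for a cyclic distance `0 < k < n`, and `0`
on the diagonal. If `σ` is the cyclic shift, then `(1 - q σ) (1 - K) = r - σ`, so that
`det (1 - T) = (r ^ n - 1) / (1 - q ^ n)`. Summing over the `m ^ n` profiles `c` gives the same
value for the probability in question, which is the asserted expression in another form.
-/

/-! ### Determinants counting absorbing choices -/

theorem Matrix.det_one_sub_of_isNilpotent {ι : Type*} [Fintype ι] [DecidableEq ι]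
    (N : Matrix ι ι ℝ) (h : IsNilpotent N) : (1 - N).det = 1 := by
  have h1 := Matrix.isNilpotent_charpoly_sub_pow_of_isNilpotent h
  have h2 : N.charpoly = Polynomial.X ^ Fintype.card ι := sub_eq_zero.1 h1.eq_zero
  have h3 := Matrix.eval_charpoly N 1
  rw [h2] at h3
  simpa using h3.symm

theorem exists_iterate_iff {V : Type*} (C : V → Prop) (φ : V → V) (v : V) (hv : ¬ C v) :
    (∃ k, C (φ^[k] v)) ↔ ∃ k, C (φ^[k] (φ v)) := by
  constructor
  · rintro ⟨k, hk⟩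
    cases k with
    | zero => exact absurd hk hv
    | succ k => exact ⟨k, hk⟩
  · rintro ⟨k, hk⟩
    exact ⟨k + 1, hk⟩

/-- The transition matrix of a deterministic map, killed on a set which every orbit meets, is
nilpotent. -/
theorem isNilpotent_of_exists_iterate {V : Type*} [Fintype V] [DecidableEq V] (C : V → Prop)
    [DecidablePred C] (φ : V → V) (h : ∀ v, ∃ k, C (φ^[k] v)) :
    IsNilpotent (Matrix.of fun v w : V => if C v then (0 : ℝ) else if w = φ v then 1 else 0) := by
  set N : Matrix V V ℝ := Matrix.of fun v w : V => if C v then (0 : ℝ) else if w = φ v then 1 else 0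
    with hN
  choose k hk using h
  have key : ∀ K : ℕ, ∀ v, (∃ j < K, C (φ^[j] v)) → ∀ w, (N ^ K) v w = 0 := by
    intro K
    induction K with
    | zero => rintro v ⟨j, hj, -⟩; omega
    | succ K ih =>
      rintro v ⟨j, hj, hC⟩ w
      rw [pow_succ', Matrix.mul_apply]
      by_cases hv : C v
      · simp [hN, hv]
      · simp only [hN, Matrix.of_apply, hv, if_false, ite_mul, one_mul, zero_mul,
          Finset.sum_ite_eq', Finset.mem_univ, if_true]
        cases j with
        | zero => exact absurd hC hv
        | succ j => exact ih _ ⟨j, by omega, hC⟩ w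
  refine ⟨Finset.univ.sup k + 1, ?_⟩
  ext v w
  exact key _ v ⟨k v, Nat.lt_succ_of_le (Finset.le_sup (Finset.mem_univ v)), hk v⟩ w

open Classical in
/-- If all orbits meet `C`, the matrix is `1 - N` with `N` nilpotent. Otherwise it has a zero row,
or the indicator function of the points whose orbits avoid `C` is in its kernel. -/
theorem det_rows_eq_ite {V α : Type*} [Fintype V] [DecidableEq V] [DecidableEq α] (C : V → Prop)
    [DecidablePred C] (next : V → α → V) (target : V → α) (β : V → α) :
    Matrix.det (Matrix.of fun v w : V =>
      if C v then (if β v = target v then (if w = v then (1 : ℝ) else 0) else 0)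
      else (if w = v then 1 else 0) - (if w = next v (β v) then 1 else 0)) =
    if (∀ v, C v → β v = target v) ∧ ∀ v, ∃ k, C ((fun v => next v (β v))^[k] v) then 1 else 0 := by
  set φ : V → V := fun v => next v (β v)
  split_ifs with h
  · refine Eq.trans (congrArg Matrix.det ?_)
      (Matrix.det_one_sub_of_isNilpotent _ (isNilpotent_of_exists_iterate C φ h.2))
    ext v w
    by_cases hv : C v
    · simp [hv, h.1 v hv, Matrix.one_apply, eq_comm (a := v)]
    · simp [hv, Matrix.one_apply, eq_comm (a := v), φ]
  · by_cases h1 : ∀ v, C v → β v = target v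
    · have h2 : ∃ v, ¬ ∃ k, C (φ^[k] v) := by
        by_contra h3
        push Not at h3
        exact h ⟨h1, h3⟩
      obtain ⟨v₀, hv₀⟩ := h2
      rw [← Matrix.exists_mulVec_eq_zero_iff]
      refine ⟨fun v => if ∃ k, C (φ^[k] v) then 0 else 1, fun h0 => ?_, ?_⟩
      · have := congrFun h0 v₀
        simp [hv₀] at this
      · ext v
        by_cases hv : C v
        · have : ∃ k, C (φ^[k] v) := ⟨0, hv⟩
          simp only [Matrix.mulVec, dotProduct, Matrix.of_apply, hv, h1 v hv, if_true, ite_mul,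
            one_mul, zero_mul, Finset.sum_ite_eq', Finset.mem_univ, Pi.zero_apply, this]
        · have := exists_iterate_iff C φ v hv
          simp only [Matrix.mulVec, dotProduct, Matrix.of_apply, hv, if_false, sub_mul, ite_mul,
            one_mul, zero_mul, Finset.sum_sub_distrib, Finset.sum_ite_eq', Finset.mem_univ, if_true,
            Pi.zero_apply]
          change (if _ then _ else _) - (if ∃ k, C (φ^[k] (φ v)) then (0 : ℝ) else 1) = 0
          rw [if_congr this rfl rfl, sub_self]
    · push Not at h1
      obtain ⟨v, hv, hne⟩ := h1
      refine Matrix.det_eq_zero_of_row_eq_zero v fun w => ?_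
      simp [hv, hne]

open Classical in
/-- A matrix-tree theorem: the number of ways to choose a successor for every `v` such that `target`
is chosen on `C` and all orbits meet `C`, as a determinant. -/
theorem card_absorbing_choices_eq_det {V α : Type*} [Fintype V] [DecidableEq V] [Fintype α]
    [DecidableEq α] (C : V → Prop) [DecidablePred C] (next : V → α → V) (target : V → α) :
    ((Finset.univ.filter fun β : V → α => (∀ v, C v → β v = target v) ∧
        ∀ v, ∃ k, C ((fun v => next v (β v))^[k] v)).card : ℝ) =
    Matrix.det (Matrix.of fun v w : V =>
      if C v then (if w = v then (1 : ℝ) else 0)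
      else ∑ a, ((if w = v then 1 else 0) - (if w = next v a then 1 else 0))) := by
  rw [Finset.card_filter]
  push_cast
  rw [Finset.sum_congr rfl fun β _ => (det_rows_eq_ite C next target β).symm]
  have := (Matrix.detRowAlternating (R := ℝ) (n := V)).toMultilinearMap.map_sum
    (fun (v : V) (a : α) => (fun w : V =>
      if C v then (if a = target v then (if w = v then (1 : ℝ) else 0) else 0)
      else (if w = v then 1 else 0) - (if w = next v a then 1 else 0)))
  refine Eq.trans this.symm ?_
  change Matrix.det _ = _
  congr 1
  ext v w
  rw [Finset.sum_apply]
  by_cases hv : C v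
  · simp [hv]
  · simp only [hv, if_false, Matrix.of_apply]

/-- The permutation matrix of `i ↦ i + 1` on `Fin n`. -/
def cyclicShift (n : ℕ) [NeZero n] : Matrix (Fin n) (Fin n) ℝ :=
  Matrix.of fun i j => if j = i + 1 then 1 else 0


/-! ### The cyclic shift -/

theorem eq_one_or_eq_finRotate {n : ℕ} (hn : 2 ≤ n) (τ : Equiv.Perm (Fin n))
    (h : ∀ i, τ i = i ∨ τ i = finRotate n i) : τ = 1 ∨ τ = finRotate n := by
  obtain ⟨k, rfl⟩ := Nat.exists_eq_add_of_le' hn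
  by_cases h1 : ∃ i, τ i ≠ i
  · obtain ⟨i₀, hi₀⟩ := h1
    have hne : ∀ i : Fin (k + 2), finRotate (k + 2) i ≠ i := fun i hi => by
      have := Finset.mem_univ i
      rw [← support_finRotate (n := k), Equiv.Perm.mem_support] at this
      exact this hi
    have hall : ∀ p : ℕ, τ ((finRotate (k + 2) ^ p) i₀) ≠ (finRotate (k + 2) ^ p) i₀ := by
      intro p
      induction p with
      | zero => simpa using hi₀
      | succ p ih =>
        rw [pow_succ', Equiv.Perm.mul_apply]
        intro hp
        have h3 := (h _).resolve_left ih
        exact hne _ (τ.injective (hp.trans h3.symm))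
    right
    ext1 i
    obtain ⟨p, rfl⟩ := isCycle_finRotate.exists_pow_eq (hne i₀) (hne i)
    exact (h _).resolve_left (hall p)
  · push Not at h1
    exact Or.inl (Equiv.ext h1)

/-- Only the identity and the rotation contribute to the Leibniz expansion. -/
theorem det_smul_one_sub_smul_cyclicShift (n : ℕ) [NeZero n] (hn : 2 ≤ n) (x y : ℝ) :
    (x • (1 : Matrix (Fin n) (Fin n) ℝ) - y • cyclicShift n).det = x ^ n - y ^ n := by
  have hrot : ∀ i : Fin n, finRotate n i = i + 1 := fun i => finRotate_apply i
  have hne : ∀ i : Fin n, i + 1 ≠ i := by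
    intro i h
    have : (1 : Fin n) = 0 := by simpa using h
    rw [Fin.ext_iff, Fin.val_one', Nat.mod_eq_of_lt (by omega)] at this
    simp at this
  have hne' : (1 : Equiv.Perm (Fin n)) ≠ finRotate n := fun h =>
    hne 0 (by rw [← hrot, ← h]; rfl)
  rw [← Matrix.det_transpose, Matrix.det_apply]
  rw [← Finset.sum_subset (Finset.subset_univ {1, finRotate n}) ?_, Finset.sum_pair hne']
  · have h1 : ∀ i : Fin n, i ≠ i + 1 := fun i => (hne i).symm
    obtain ⟨k, rfl⟩ := Nat.exists_eq_add_of_le' hn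
    simp [cyclicShift, hrot, h1, sign_finRotate, Units.smul_def]
    rw [neg_pow y, pow_succ (-1 : ℝ) (k + 1), ← mul_assoc, ← mul_assoc, ← mul_pow]
    norm_num
    ring
  · intro τ _ hτ
    simp only [Finset.mem_insert, Finset.mem_singleton, not_or] at hτ
    obtain ⟨i, hi⟩ : ∃ i, ¬ (τ i = i ∨ τ i = finRotate n i) := by
      by_contra hcon
      push Not at hcon
      rcases eq_one_or_eq_finRotate hn τ hcon with h | h
      exacts [hτ.1 h, hτ.2 h]
    rw [not_or, hrot] at hi
    rw [Finset.prod_eq_zero (Finset.mem_univ i), smul_zero]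
    simp [cyclicShift, hi.2, Ne.symm hi.1]

/-! ### Ages and decision nodes -/

/-- The residue of `i - 1 - j` modulo `n`: when player `i` is about to move in the cyclic order,
this is the number of players who moved since the last move of player `j`. -/
def age {n : ℕ} (i j : Fin n) : ℕ :=
  if (j : ℕ) < i then (i : ℕ) - 1 - j else (i : ℕ) + n - 1 - j

theorem fin_val_add_one {n : ℕ} [NeZero n] (i : Fin n) :
    ((i + 1 : Fin n) : ℕ) = if (i : ℕ) + 1 = n then 0 else (i : ℕ) + 1 := by
  have := i.isLt
  rw [Fin.val_add, Fin.val_one', Nat.add_mod_mod]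
  split_ifs with h
  · rw [h, Nat.mod_self]
  · exact Nat.mod_eq_of_lt (by omega)

theorem age_lt {n : ℕ} (i j : Fin n) : age i j < n := by
  have := i.isLt; have := j.isLt; unfold age; split_ifs <;> omega

theorem age_self {n : ℕ} (i : Fin n) : age i i = n - 1 := by
  have := i.isLt; unfold age; split_ifs <;> omega

theorem age_eq_iff {n : ℕ} (i j : Fin n) : age i j = n - 1 ↔ i = j := by
  have := i.isLt; have := j.isLt; rw [Fin.ext_iff]; unfold age; split_ifs <;> omega

theorem age_succ_left_of_ne {n : ℕ} [NeZero n] {i j : Fin n} (h : j ≠ i) :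
    age (i + 1) j = age i j + 1 := by
  have := i.isLt; have := j.isLt; have := fin_val_add_one i
  rw [Ne, Fin.ext_iff] at h; unfold age; split_ifs at * <;> omega

theorem age_succ_left_self {n : ℕ} [NeZero n] (i : Fin n) : age (i + 1) i = 0 := by
  have := i.isLt; have := fin_val_add_one i
  unfold age; split_ifs at * <;> omega

theorem age_succ_right_of_ne {n : ℕ} [NeZero n] {i j : Fin n} (h' : j ≠ i + 1) :
    age j (i + 1) + 1 = age j i := by
  have := i.isLt; have := j.isLt; have := fin_val_add_one i
  rw [Ne, Fin.ext_iff] at h'; unfold age; split_ifs at * <;> omega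

theorem age_succ_self {n : ℕ} [NeZero n] (hn : 2 ≤ n) (i : Fin n) : age i (i + 1) = n - 2 := by
  have := i.isLt; have := fin_val_add_one i
  unfold age; split_ifs at * <;> omega

theorem fin_add_one_ne {n : ℕ} [NeZero n] (hn : 2 ≤ n) (i : Fin n) : i + 1 ≠ i := by
  have := i.isLt; have := fin_val_add_one i
  rw [Ne, Fin.ext_iff]; split_ifs at * <;> omega

/-- Decision nodes: a player, and the strategies of the others. The environment is encoded as a full
profile in which the player's own strategy is normalized to be the one in the target profile `c`. -/
abbrev Node {n m : ℕ} (c : Fin n → Fin m) : Type :=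
  {v : Fin n × (Fin n → Fin m) // v.2 v.1 = c v.1}

namespace Node

variable {n m : ℕ} {c : Fin n → Fin m}

/-- The player who moves at a decision node. -/
def player (v : Node c) : Fin n := v.1.1

/-- The environment of a decision node, as a normalized profile. -/
def profile (v : Node c) : Fin n → Fin m := v.1.2

theorem profile_player (v : Node c) : v.profile v.player = c v.player := v.2

theorem ext {v w : Node c} (h₁ : v.player = w.player) (h₂ : v.profile = w.profile) : v = w :=
  Subtype.ext (Prod.ext h₁ h₂)

/-- The decision node of player `i` in the environment `s_{-i}`. -/
def of (c : Fin n → Fin m) (i : Fin n) (s : Fin n → Fin m) : Node c :=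
  ⟨(i, Function.update s i (c i)), by simp⟩

@[simp] theorem player_of (i : Fin n) (s : Fin n → Fin m) : (of c i s).player = i := rfl
@[simp] theorem profile_of (i : Fin n) (s : Fin n → Fin m) :
    (of c i s).profile = Function.update s i (c i) := rfl

theorem of_player_profile (v : Node c) : of c v.player v.profile = v :=
  ext rfl (by rw [profile_of, ← v.profile_player, Function.update_eq_self])

theorem profile_of_target (i : Fin n) : (of c i c).profile = c := by simp

/-- The last `l` movers before player `i` play the same strategies in `s` and in `s'`. -/
def Agree (l : ℕ) (i : Fin n) (s s' : Fin n → Fin m) : Prop := ∀ j, age i j < l → s j = s' j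

theorem Agree.mono {l l' : ℕ} (h : l ≤ l') {i : Fin n} {s s' : Fin n → Fin m}
    (H : Agree l' i s s') : Agree l i s s' := fun j hj => H j (hj.trans_le h)

theorem agree_zero (i : Fin n) (s s' : Fin n → Fin m) : Agree 0 i s s' :=
  fun _ hj => absurd hj (Nat.not_lt_zero _)

theorem profile_eq_of_agree {l : ℕ} (hl : n - 1 ≤ l) {i : Fin n} {v w : Node c} (hv : v.player = i)
    (hw : w.player = i) (h : Agree l i v.profile w.profile) : v.profile = w.profile := by
  funext j
  by_cases hj : i = j
  · subst hj
    rw [← hv, profile_player, hv, ← hw, profile_player]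
  · refine h j ?_
    have := age_lt i j
    have := mt (age_eq_iff i j).1 hj
    omega

theorem profile_eq_iff_agree {v : Node c} {l : ℕ} (hl : n - 1 ≤ l) :
    v.profile = c ↔ Agree l v.player v.profile c := by
  constructor
  · intro h j _; rw [h]
  · intro h
    have := profile_eq_of_agree (v := v) (w := of c v.player c) hl rfl rfl
      (by rwa [profile_of_target])
    rwa [profile_of_target] at this

/-- The nodes have the same player, agree in the last `l` moves, and have equally long runs of
recent agreements with the target profile `c`. -/
structure Similar (l : ℕ) (v w : Node c) : Prop where
  player_eq : v.player = w.player
  agree : Agree l v.player v.profile w.profile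
  agree_iff : ∀ d, Agree d v.player v.profile c ↔ Agree d v.player w.profile c

theorem Similar.mono {l l' : ℕ} (h : l ≤ l') {v w : Node c} (H : Similar l' v w) : Similar l v w :=
  ⟨H.player_eq, H.agree.mono h, H.agree_iff⟩

theorem Similar.profile_eq_iff {l : ℕ} {v w : Node c} (H : Similar l v w) :
    v.profile = c ↔ w.profile = c := by
  rw [profile_eq_iff_agree le_rfl, profile_eq_iff_agree le_rfl, H.agree_iff, H.player_eq]

theorem Similar.eq {v w : Node c} (H : Similar (n - 1) v w) : v = w :=
  ext H.player_eq (profile_eq_of_agree le_rfl rfl H.player_eq.symm H.agree)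

variable [NeZero n]

/-- The decision node of the next player after strategy `a` is chosen at the node `v`. -/
def step (v : Node c) (a : Fin m) : Node c :=
  of c (v.player + 1) (Function.update v.profile v.player a)

@[simp] theorem player_step (v : Node c) (a : Fin m) : (v.step a).player = v.player + 1 := rfl

theorem profile_step_apply_player (hn : 2 ≤ n) (v : Node c) (a : Fin m) :
    (v.step a).profile v.player = a := by
  rw [step, profile_of, Function.update_of_ne (fin_add_one_ne hn _).symm, Function.update_self]

theorem profile_step_apply_of_ne (v : Node c) (a : Fin m) {j : Fin n} (h : j ≠ v.player)
    (h' : j ≠ v.player + 1) : (v.step a).profile j = v.profile j := by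
  rw [step, profile_of, Function.update_of_ne h', Function.update_of_ne h]

theorem profile_step_apply_succ (v : Node c) (a : Fin m) :
    (v.step a).profile (v.player + 1) = c (v.player + 1) := (v.step a).profile_player

theorem agree_step (hn : 2 ≤ n) {l : ℕ} {v w : Node c} (h : v.player = w.player) (a : Fin m)
    (H : Agree l v.player v.profile w.profile) :
    Agree (l + 1) (v.player + 1) (v.step a).profile (w.step a).profile := by
  intro j hj
  by_cases h₁ : j = v.player
  · rw [h₁, profile_step_apply_player hn, h, profile_step_apply_player hn]
  by_cases h₂ : j = v.player + 1
  · rw [h₂, profile_step_apply_succ, h, profile_step_apply_succ]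
  rw [age_succ_left_of_ne h₁] at hj
  rw [profile_step_apply_of_ne v a h₁ h₂, profile_step_apply_of_ne w a (h ▸ h₁) (h ▸ h₂)]
  exact H j (by omega)

/-- The minimum accounts for player `v.player + 1`, whose strategy is dropped from the environment:
it is the one of age `n - 2` at `v`. -/
theorem agree_step_target (hn : 2 ≤ n) (l : ℕ) (v : Node c) (a : Fin m) :
    Agree (l + 1) (v.player + 1) (v.step a).profile c ↔
      a = c v.player ∧ Agree (min l (n - 2)) v.player v.profile c := by
  constructor
  · intro H
    refine ⟨?_, fun j hj => ?_⟩
    · rw [← H v.player (by rw [age_succ_left_self]; omega), profile_step_apply_player hn]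
    · have h₁ : j ≠ v.player := by
        rintro rfl; rw [age_self] at hj; omega
      have h₂ : j ≠ v.player + 1 := by
        rintro rfl; rw [age_succ_self hn] at hj; omega
      rw [← profile_step_apply_of_ne v a h₁ h₂]
      exact H j (by rw [age_succ_left_of_ne h₁]; omega)
  · rintro ⟨rfl, H⟩ j hj
    by_cases h₁ : j = v.player
    · rw [h₁, profile_step_apply_player hn]
    by_cases h₂ : j = v.player + 1
    · rw [h₂, profile_step_apply_succ]
    rw [profile_step_apply_of_ne v _ h₁ h₂]
    refine H j ?_
    rw [age_succ_left_of_ne h₁] at hj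
    have a1 := mt (age_eq_iff v.player j).1 (Ne.symm h₁)
    have a2 := age_lt v.player j
    have a3 : age v.player j ≠ n - 2 := by
      intro h
      have := age_succ_left_of_ne h₁
      rw [h] at this
      exact h₂ ((age_eq_iff _ _).1 (by omega : age (v.player + 1) j = n - 1)).symm
    omega

theorem Similar.step (hn : 2 ≤ n) {l : ℕ} {v w : Node c} (H : Similar l v w) (a : Fin m) :
    Similar (l + 1) (v.step a) (w.step a) := by
  refine ⟨by rw [player_step, player_step, H.player_eq], agree_step hn H.player_eq a H.agree, ?_⟩
  rintro (_ | d)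
  · exact iff_of_true (agree_zero _ _ _) (agree_zero _ _ _)
  · rw [player_step, agree_step_target hn, H.agree_iff, H.player_eq, agree_step_target hn]

theorem not_agree_fresh (hn : 2 ≤ n) {t : Fin n → Fin m} (ht : ∀ i, t i ≠ c i) {d : ℕ} (hd : 0 < d)
    (i : Fin n) : ¬ Agree d i (of c i t).profile c := by
  intro h
  have h0 : age i (i - 1) = 0 := by
    have := age_succ_left_self (i - 1); rwa [sub_add_cancel] at this
  have := h (i - 1) (by omega)
  rw [profile_of, Function.update_of_ne] at this
  · exact ht _ this
  · have := fin_add_one_ne hn (i - 1); rw [sub_add_cancel] at this; exact this.symm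

end Node

/-! ### The determinant of the killed walk -/

namespace Node

open Classical in
/-- The random walk on decision nodes that chooses each strategy with weight `q` and is killed when
the target profile `c` is reached. -/
noncomputable def killedWalk {n m : ℕ} [NeZero n] (c : Fin n → Fin m) (q : ℝ) :
    Matrix (Node c) (Node c) ℝ :=
  Matrix.of fun v w => if v.profile = c then 0 else ∑ a, if w = v.step a then q else 0

open Classical in
/-- The weight `1 - q` with which a strategy other than the one in `c` is chosen at a node, recorded
at the next player. -/
noncomputable def departure {n m : ℕ} [NeZero n] (c : Fin n → Fin m) (q : ℝ) :
    Matrix (Node c) (Fin n) ℝ :=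
  Matrix.of fun v j => if v.profile = c then 0 else if j = v.player + 1 then 1 - q else 0

open Classical in
/-- Evaluation of functions at the nodes of the profile `t`. For `t` differing from `c` in all
coordinates, these represent the nodes reached right after a deviation from `c`. -/
noncomputable def freshRead {n m : ℕ} (c t : Fin n → Fin m) : Matrix (Fin n) (Node c) ℝ :=
  Matrix.of fun j w => if w = of c j t then 1 else 0

/-- The killed walk, with the nodes of `t` subtracted to compensate for deviations from `c`. On
functions of the player and the run of agreements with `c`, it is the walk killed at the first
deviation from `c`. -/
noncomputable def excursion {n m : ℕ} [NeZero n] (c t : Fin n → Fin m) (q : ℝ) :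
    Matrix (Node c) (Node c) ℝ :=
  killedWalk c q - departure c q * freshRead c t

open Classical in
/-- The solution `(1 - N)⁻¹ A`, where `N` is `excursion` and `A` is `departure`: the weight that the
first deviation from `c` happens right before the turn of player `j`, and before the walk is killed.
-/
noncomputable def green {n m : ℕ} (c : Fin n → Fin m) (q : ℝ) :
    Matrix (Node c) (Fin n) ℝ :=
  Matrix.of fun v j => if Agree (n - 1 - age j v.player) v.player v.profile c then 0
    else (1 - q) * q ^ age j v.player

/-- The weights between consecutive deviations from `c`, as a circulant matrix. A full round without
deviation is killed, hence the zero diagonal. -/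
noncomputable def renewal (n : ℕ) (q : ℝ) : Matrix (Fin n) (Fin n) ℝ :=
  Matrix.of fun i j => if i = j then 0 else (1 - q) * q ^ age j i

variable {n m : ℕ} {c t : Fin n → Fin m} {q : ℝ}

theorem green_of_agree {v : Node c} {j : Fin n}
    (h : Agree (n - 1 - age j v.player) v.player v.profile c) : green c q v j = 0 := if_pos h

theorem green_of_not_agree {v : Node c} {j : Fin n}
    (h : ¬ Agree (n - 1 - age j v.player) v.player v.profile c) :
    green c q v j = (1 - q) * q ^ age j v.player := if_neg h

variable [NeZero n]

open Classical in
theorem excursion_mulVec (f : Node c → ℝ) (v : Node c) :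
    (excursion c t q).mulVec f v = if v.profile = c then 0
      else q * ∑ a, f (v.step a) - (1 - q) * f (of c (v.player + 1) t) := by
  rw [excursion, Matrix.sub_mulVec, Pi.sub_apply, ← Matrix.mulVec_mulVec]
  have h1 : ∀ j, (freshRead c t).mulVec f j = f (of c j t) := fun j => by
    simp [freshRead, Matrix.mulVec, dotProduct]
  have h2 : ∀ g : Fin n → ℝ, (departure c q).mulVec g v =
      if v.profile = c then 0 else (1 - q) * g (v.player + 1) := fun g => by
    by_cases hv : v.profile = c <;> simp [departure, Matrix.mulVec, dotProduct, hv]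
  have h3 : (killedWalk c q).mulVec f v =
      if v.profile = c then 0 else q * ∑ a, f (v.step a) := by
    by_cases hv : v.profile = c
    · simp [killedWalk, Matrix.mulVec, dotProduct, hv]
    · simp only [killedWalk, Matrix.mulVec, dotProduct, Matrix.of_apply, hv, if_false,
        Finset.sum_mul, Finset.mul_sum]
      rw [Finset.sum_comm]
      simp
  rw [h2, h3, h1]
  split_ifs <;> ring

open Classical in
theorem excursion_mulVec_of_eq (hq : q * m = 1) (f : Node c → ℝ) (v : Node c)
    (hf : ∀ a, a ≠ c v.player → f (v.step a) = f (of c (v.player + 1) t)) :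
    (excursion c t q).mulVec f v = if v.profile = c then 0 else q * f (v.step (c v.player)) := by
  rw [excursion_mulVec]
  split_ifs
  · rfl
  · have hm : 1 ≤ m := Nat.one_le_iff_ne_zero.2 (by rintro rfl; simp at hq)
    rw [← Finset.add_sum_erase _ _ (Finset.mem_univ (c v.player)),
      Finset.sum_congr rfl fun a ha => hf a (Finset.ne_of_mem_erase ha), Finset.sum_const,
      Finset.card_erase_of_mem (Finset.mem_univ _), Finset.card_univ, Fintype.card_fin,
      nsmul_eq_mul, Nat.cast_sub hm]
    push_cast
    linear_combination f (of c (v.player + 1) t) * hq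

/-- One turn forgets one of the remembered moves. -/
theorem excursion_mulVec_congr (hn : 2 ≤ n) {l : ℕ} (f : Node c → ℝ)
    (hf : ∀ v w, Similar (l + 1) v w → f v = f w) (v w : Node c) (h : Similar l v w) :
    (excursion c t q).mulVec f v = (excursion c t q).mulVec f w := by
  classical
  rw [excursion_mulVec, excursion_mulVec, h.player_eq]
  simp only [h.profile_eq_iff, fun a => hf _ _ (h.step hn a)]

/-- A deviation from `c` leads to a node without recent agreements, as are the nodes of `t`. -/
theorem step_similar_fresh (hn : 2 ≤ n) (ht : ∀ i, t i ≠ c i) (v : Node c) (a : Fin m)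
    (ha : a ≠ c v.player) : Similar 0 (v.step a) (of c (v.player + 1) t) := by
  refine ⟨rfl, agree_zero _ _ _, ?_⟩
  rintro (_ | d)
  · exact iff_of_true (agree_zero _ _ _) (agree_zero _ _ _)
  · refine iff_of_false ?_ (not_agree_fresh hn ht (Nat.succ_pos d) _)
    rw [player_step, agree_step_target hn]
    exact fun h => ha h.1

/-- After `n - 1` turns a function depends only on the player and on the run of agreements with `c`;
each further turn makes it vanish on runs shorter by one. -/
theorem excursion_isNilpotent (hn : 2 ≤ n) (hq : q * m = 1) (ht : ∀ i, t i ≠ c i) :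
    IsNilpotent (excursion c t q) := by
  classical
  set E := excursion c t q
  -- Iterates of an arbitrary function forget the environment.
  have h1 : ∀ k ≤ n - 1, ∀ f : Node c → ℝ, ∀ v w, Similar (n - 1 - k) v w →
      (E ^ k).mulVec f v = (E ^ k).mulVec f w := by
    intro k
    induction k with
    | zero =>
      intro _ f v w h
      rw [h.eq]
    | succ k ih =>
      intro hk f v w h
      rw [pow_succ', ← Matrix.mulVec_mulVec]
      refine excursion_mulVec_congr hn _ (fun v w h => ih (by omega) f v w ?_) v w h
      rwa [show n - 1 - k = n - 1 - (k + 1) + 1 by omega]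
  -- Iterates of a function of the run of agreements vanish on shorter and shorter runs.
  have h2 : ∀ k ≤ n - 1, ∀ f : Node c → ℝ, (∀ v w, Similar 0 v w → f v = f w) →
      (∀ v w, Similar 0 v w → (E ^ (k + 1)).mulVec f v = (E ^ (k + 1)).mulVec f w) ∧
      ∀ v : Node c, Agree (n - 1 - k) v.player v.profile c → (E ^ (k + 1)).mulVec f v = 0 := by
    intro k
    induction k with
    | zero =>
      intro _ f hf
      rw [zero_add, pow_one]
      refine ⟨excursion_mulVec_congr hn f fun v w h => hf v w (h.mono (Nat.zero_le _)),
        fun v hv => ?_⟩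
      rw [excursion_mulVec, if_pos ((profile_eq_iff_agree le_rfl).2 hv)]
    | succ k ih =>
      intro hk f hf
      obtain ⟨ih1, ih2⟩ := ih (by omega) f hf
      rw [pow_succ', ← Matrix.mulVec_mulVec]
      refine ⟨excursion_mulVec_congr hn _ fun v w h => ih1 v w (h.mono (Nat.zero_le _)),
        fun v hv => ?_⟩
      rw [excursion_mulVec_of_eq hq _ v fun a ha => ih1 _ _ (step_similar_fresh hn ht v a ha),
        ih2, mul_zero, ite_self]
      rw [show n - 1 - k = n - 1 - (k + 1) + 1 by omega, player_step, agree_step_target hn]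
      exact ⟨rfl, hv.mono (min_le_left _ _)⟩
  refine ⟨(n - 1 + 1) + (n - 1), ?_⟩
  have h3 : ∀ f : Node c → ℝ, (E ^ ((n - 1 + 1) + (n - 1))).mulVec f = 0 := by
    intro f
    ext v
    rw [pow_add, ← Matrix.mulVec_mulVec]
    refine (h2 (n - 1) le_rfl _ fun v w h => h1 (n - 1) le_rfl f v w ?_).2 v ?_
    · rwa [Nat.sub_self]
    · rw [Nat.sub_self]; exact agree_zero _ _ _
  ext v w
  have := congrFun (h3 (Pi.single w 1)) v
  rwa [Matrix.mulVec_single_one] at this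

theorem one_sub_excursion_mul_green (hn : 2 ≤ n) (hq : q * m = 1) (ht : ∀ i, t i ≠ c i) :
    (1 - excursion c t q) * green c q = departure c q := by
  classical
  ext v j
  rw [Matrix.sub_mul, Matrix.one_mul, Matrix.sub_apply]
  have hmul : (excursion c t q * green c q) v j =
      (excursion c t q).mulVec (fun w => green c q w j) v := rfl
  rw [hmul, excursion_mulVec_of_eq hq]
  · simp only [departure, Matrix.of_apply]
    by_cases hv : v.profile = c
    · rw [if_pos hv, if_pos hv, sub_zero, green_of_agree]
      rw [hv]
      exact fun _ _ => rfl
    · rw [if_neg hv, if_neg hv]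
      by_cases hj : j = v.player + 1
      · subst hj
        rw [green_of_not_agree, green_of_agree, age_succ_left_self, if_pos rfl]
        · ring
        · rw [player_step, age_self, Nat.sub_self]
          exact agree_zero _ _ _
        · rwa [age_succ_left_self, ← profile_eq_iff_agree (Nat.sub_zero _).ge]
      · have h1 := age_succ_right_of_ne hj
        have h2 := age_lt j v.player
        have h3 : Agree (n - 1 - age j (v.step (c v.player)).player) (v.step (c v.player)).player
            (v.step (c v.player)).profile c ↔
            Agree (n - 1 - age j v.player) v.player v.profile c := by
          rw [player_step, show n - 1 - age j (v.player + 1) = n - 1 - age j v.player + 1 by omega,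
            agree_step_target hn, min_eq_left (by omega)]
          exact and_iff_right rfl
        rw [if_neg hj]
        by_cases h : Agree (n - 1 - age j v.player) v.player v.profile c
        · rw [green_of_agree h, green_of_agree (h3.2 h)]
          ring
        · rw [green_of_not_agree h, green_of_not_agree (mt h3.1 h), player_step, ← h1]
          ring
  · intro a ha
    have := (step_similar_fresh hn ht v a ha).agree_iff
    simp only [green, Matrix.of_apply]
    exact if_congr (this _) rfl rfl

theorem freshRead_mul_green (hn : 2 ≤ n) (ht : ∀ i, t i ≠ c i) :
    freshRead c t * green c q = renewal n q := by
  classical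
  ext i j
  have h : (freshRead c t * green c q) i j = green c q (of c i t) j := by
    simp [freshRead, Matrix.mul_apply]
  rw [h]
  simp only [green, renewal, Matrix.of_apply, player_of]
  refine if_congr ?_ rfl rfl
  constructor
  · intro h
    by_contra hij
    have h1 := mt (age_eq_iff j i).1 (Ne.symm hij)
    have h2 := age_lt j i
    exact not_agree_fresh hn ht (by omega) i h
  · rintro rfl
    rw [age_self, Nat.sub_self]
    exact agree_zero _ _ _

theorem one_sub_smul_cyclicShift_mul_renewal (hn : 2 ≤ n) (q : ℝ) :
    (1 - q • cyclicShift n) * (1 - renewal n q) =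
      (1 + (1 - q) * q ^ (n - 1)) • (1 : Matrix (Fin n) (Fin n) ℝ) - cyclicShift n := by
  ext i j
  have h : (cyclicShift n * renewal n q) i j = renewal n q (i + 1) j := by
    simp [cyclicShift, Matrix.mul_apply]
  simp only [Matrix.sub_mul, Matrix.mul_sub, Matrix.one_mul, Matrix.mul_one, Matrix.smul_mul,
    Matrix.sub_apply, Matrix.smul_apply, smul_eq_mul, h]
  simp only [renewal, cyclicShift, Matrix.of_apply, Matrix.one_apply]
  by_cases hij : i = j
  · subst hij
    have h1 := fin_add_one_ne hn i
    rw [if_pos rfl, if_pos rfl, if_neg h1.symm, if_neg h1, age_succ_self hn,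
      show n - 1 = n - 2 + 1 by omega]
    ring
  · by_cases hj : j = i + 1
    · subst hj
      simp only [if_neg hij, if_true, age_succ_left_self]
      ring
    · rw [if_neg hij, if_neg hij, if_neg hj, if_neg (Ne.symm hj), ← age_succ_right_of_ne hj]
      ring

theorem det_one_sub_killedWalk (hn : 2 ≤ n) (hq : q * m = 1) (hm : 2 ≤ m) (c : Fin n → Fin m) :
    (1 - q ^ n) * (1 - killedWalk c q).det = (1 + (1 - q) * q ^ (n - 1)) ^ n - 1 := by
  classical
  obtain ⟨t, ht⟩ : ∃ t : Fin n → Fin m, ∀ i, t i ≠ c i := by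
    have : Nontrivial (Fin m) := Fin.nontrivial_iff_two_le.2 hm
    choose t ht using fun i => exists_ne (c i)
    exact ⟨t, ht⟩
  have h1 : 1 - killedWalk c q =
      (1 - excursion c t q) * (1 - green c q * freshRead c t) := by
    rw [Matrix.mul_sub, Matrix.mul_one, ← Matrix.mul_assoc,
      one_sub_excursion_mul_green hn hq ht, excursion]
    abel
  rw [h1, Matrix.det_mul, Matrix.det_one_sub_of_isNilpotent _ (excursion_isNilpotent hn hq ht),
    one_mul, Matrix.det_one_sub_mul_comm, freshRead_mul_green hn ht]
  have h2 := congrArg Matrix.det (one_sub_smul_cyclicShift_mul_renewal hn q)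
  have h3 := det_smul_one_sub_smul_cyclicShift n hn 1 q
  have h4 := det_smul_one_sub_smul_cyclicShift n hn (1 + (1 - q) * q ^ (n - 1)) 1
  rw [one_smul, one_pow] at h3 h4
  rw [Matrix.det_mul, h3, h4] at h2
  exact h2

end Node

/-! ### The distribution of the best responses -/

instance isProbabilityMeasure_randomGame (n m : ℕ) : IsProbabilityMeasure (randomGame n m) := by
  unfold randomGame; infer_instance

theorem ae_ne_of_indepFun {Ω : Type*} [MeasurableSpace Ω] {μ : Measure Ω} [IsProbabilityMeasure μ]
    {X Y : Ω → ℝ} (hX : Measurable X) (hY : Measurable Y) (h : IndepFun X Y μ)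
    (hY₀ : ∀ x, (μ.map Y) {x} = 0) : ∀ᵐ ω ∂μ, X ω ≠ Y ω := by
  have h1 := (indepFun_iff_map_prod_eq_prod_map_map hX.aemeasurable hY.aemeasurable).1 h
  have hd : MeasurableSet {p : ℝ × ℝ | p.1 = p.2} :=
    measurableSet_eq_fun measurable_fst measurable_snd
  have h2 : (μ.map fun ω => (X ω, Y ω)) {p | p.1 = p.2} = 0 := by
    have := Measure.isProbabilityMeasure_map (μ := μ) hY.aemeasurable
    rw [h1, Measure.measure_prod_null hd]
    refine Filter.Eventually.of_forall fun x => ?_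
    have : Prod.mk x ⁻¹' {p : ℝ × ℝ | p.1 = p.2} = {x} := by
      ext y; simp [eq_comm]
    change (μ.map Y) (Prod.mk x ⁻¹' {p : ℝ × ℝ | p.1 = p.2}) = 0
    rw [this]
    exact hY₀ x
  rw [Measure.map_apply (hX.prodMk hY) hd] at h2
  rw [ae_iff]
  simpa using h2

theorem ae_randomGame_payoff_ne (n m : ℕ) :
    ∀ᵐ u ∂randomGame n m, ∀ (i : Fin n) (s s' : Fin n → Fin m), s ≠ s' → u i s ≠ u i s' := by
  have key : ∀ s s' : Fin n → Fin m, s ≠ s' →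
      ∀ᵐ w ∂(Measure.pi fun _ : Fin n → Fin m => gaussianReal 0 1), w s ≠ w s' := by
    intro s s' hs
    refine ae_ne_of_indepFun (measurable_pi_apply s) (measurable_pi_apply s') ?_ fun x => ?_
    · exact (iIndepFun_pi (μ := fun _ : Fin n → Fin m => gaussianReal 0 1)
        (X := fun _ => id) fun _ => aemeasurable_id).indepFun hs
    · have := (measurePreserving_eval (fun _ : Fin n → Fin m => gaussianReal 0 1) s').map_eq
      have h2 := nullSingletonClass_gaussianReal (μ := 0) (one_ne_zero (α := NNReal))
      change (Measure.map (Function.eval s') (Measure.pi fun _ : Fin n → Fin m => gaussianReal 0 1))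
        ({x} : Set ℝ) = 0
      rw [this]
      exact measure_singleton x
  rw [ae_all_iff]
  intro i
  rw [ae_all_iff]
  intro s
  rw [ae_all_iff]
  intro s'
  by_cases hs : s = s'
  · exact Filter.Eventually.of_forall fun u h => absurd hs h
  · exact ((measurePreserving_eval (fun _ : Fin n => Measure.pi fun _ : Fin n → Fin m =>
      gaussianReal 0 1) i).quasiMeasurePreserving.ae (key s s' hs)).mono fun u hu _ => hu

theorem measurePreserving_randomGame_comp {n m : ℕ} (τ : Fin n → Equiv.Perm (Fin n → Fin m)) :
    MeasurePreserving (fun (u : Game n m) i s => u i (τ i s)) (randomGame n m)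
      (randomGame n m) := by
  refine measurePreserving_pi (fun _ => Measure.pi fun _ => gaussianReal 0 1)
    (fun _ => Measure.pi fun _ => gaussianReal 0 1)
    (f := fun i (w : (Fin n → Fin m) → ℝ) s => w (τ i s)) fun i => ?_
  have := measurePreserving_piCongrLeft (fun _ : Fin n → Fin m => gaussianReal 0 1) (τ i).symm
  convert this using 1
  funext w s
  rw [MeasurableEquiv.coe_piCongrLeft, Equiv.piCongrLeft_apply]
  simp

namespace Node
variable {n m : ℕ} {c : Fin n → Fin m}

/-- The payoff of the player who moves at `v` from the strategy `a`. -/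
def payoff (u : Game n m) (v : Node c) (a : Fin m) : ℝ :=
  u v.player (Function.update v.profile v.player a)

/-- The games in which `β v` is the unique best response at every decision node `v`. -/
def strictBestResponses (β : Node c → Fin m) : Set (Game n m) :=
  {u | ∀ v a, a ≠ β v → payoff u v a < payoff u v (β v)}

theorem measurable_payoff (v : Node c) (a : Fin m) : Measurable fun u => payoff u v a :=
  (measurable_pi_apply _).comp (measurable_pi_apply _)

theorem measurableSet_strictBestResponses (β : Node c → Fin m) :
    MeasurableSet (strictBestResponses β) := by
  simp only [strictBestResponses, Set.ofPred_forall]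
  exact MeasurableSet.iInter fun v => MeasurableSet.iInter fun a => MeasurableSet.iInter fun _ =>
    measurableSet_lt (measurable_payoff v a) (measurable_payoff v _)

theorem disjoint_strictBestResponses {β β' : Node c → Fin m} (h : β ≠ β') :
    Disjoint (strictBestResponses β) (strictBestResponses β') := by
  obtain ⟨v, hv⟩ := Function.ne_iff.1 h
  refine Set.disjoint_left.2 fun u h₁ h₂ => ?_
  exact lt_asymm (h₁ v _ hv.symm) (h₂ v _ hv)

theorem exists_mem_strictBestResponses (hm : 0 < m) {u : Game n m}
    (hu : ∀ (i : Fin n) (s s' : Fin n → Fin m), s ≠ s' → u i s ≠ u i s') :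
    ∃ β : Node c → Fin m, u ∈ strictBestResponses β := by
  have : Nonempty (Fin m) := ⟨⟨0, hm⟩⟩
  choose β hβ using fun v : Node c => Finite.exists_max (payoff u v)
  refine ⟨β, fun v a ha => lt_of_le_of_ne (hβ v a) (hu _ _ _ fun h => ha ?_)⟩
  simpa using congrFun h v.player

theorem of_update (i : Fin n) (s : Fin n → Fin m) (a : Fin m) :
    of c i (Function.update s i a) = of c i s := ext rfl (by simp)

/-- Interchange the strategies `β v` and `β' v` of player `i` at the decision node `v` of player `i`
given by the profile `s`. -/
def relabel (β β' : Node c → Fin m) (i : Fin n) (s : Fin n → Fin m) : Fin n → Fin m :=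
  Function.update s i (Equiv.swap (β (of c i s)) (β' (of c i s)) (s i))

theorem relabel_involutive (β β' : Node c → Fin m) (i : Fin n) :
    Function.Involutive (relabel β β' i) := by
  intro s
  simp [relabel, of_update]

theorem payoff_relabel (β β' : Node c → Fin m) (u : Game n m) (v : Node c) (a : Fin m) :
    payoff (fun i s => u i (relabel β β' i s)) v a = payoff u v (Equiv.swap (β v) (β' v) a) := by
  simp [payoff, relabel, of_update, of_player_profile]

/-- Interchanging payoffs preserves the law of the game, so all best response functions are equally
likely. -/
theorem measure_strictBestResponses_eq (β β' : Node c → Fin m) :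
    randomGame n m (strictBestResponses β) = randomGame n m (strictBestResponses β') := by
  rw [← (measurePreserving_randomGame_comp fun i =>
    (relabel_involutive β β' i).toPerm).measure_preimage
      (measurableSet_strictBestResponses β).nullMeasurableSet]
  congr 1
  ext u
  simp only [strictBestResponses, Set.mem_preimage, Set.mem_ofPred_eq,
    Function.Involutive.coe_toPerm, payoff_relabel, Equiv.swap_apply_left]
  refine forall_congr' fun v => ?_
  rw [(Equiv.swap (β v) (β' v)).forall_congr_left]
  simp [Equiv.swap_apply_eq_iff]

theorem measureReal_biUnion_strictBestResponses (hm : 0 < m) (G : Finset (Node c → Fin m)) :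
    (randomGame n m).real (⋃ β ∈ G, strictBestResponses β) =
      (G.card : ℝ) / (m : ℝ) ^ Fintype.card (Node c) := by
  classical
  have hsum : ∀ G : Finset (Node c → Fin m),
      (randomGame n m).real (⋃ β ∈ G, strictBestResponses β) =
        ∑ β ∈ G, (randomGame n m).real (strictBestResponses β) := fun G =>
    measureReal_biUnion_finset (fun β _ β' _ h => disjoint_strictBestResponses h)
      fun β _ => measurableSet_strictBestResponses β
  let β₀ : Node c → Fin m := fun _ => ⟨0, hm⟩
  have hconst : ∀ β : Node c → Fin m, (randomGame n m).real (strictBestResponses β) =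
      (randomGame n m).real (strictBestResponses β₀) := fun β =>
    congrArg ENNReal.toReal (measure_strictBestResponses_eq β β₀)
  have hone : (randomGame n m).real (⋃ β ∈ (Finset.univ : Finset (Node c → Fin m)),
      strictBestResponses β) = 1 := by
    rw [← probReal_univ (μ := randomGame n m)]
    refine measureReal_congr ?_
    filter_upwards [ae_randomGame_payoff_ne n m] with u hu
    obtain ⟨β, hβ⟩ := exists_mem_strictBestResponses (c := c) hm hu
    exact propext (iff_of_true (Set.mem_iUnion₂.2 ⟨β, Finset.mem_univ β, hβ⟩) trivial)
  rw [hsum, Finset.sum_congr rfl fun β _ => hconst β, Finset.sum_const, Finset.card_univ,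
    Fintype.card_fun, Fintype.card_fin, nsmul_eq_mul] at hone
  push_cast at hone
  rw [hsum, Finset.sum_congr rfl fun β _ => hconst β, Finset.sum_const, nsmul_eq_mul,
    eq_div_iff (by positivity), mul_assoc, mul_comm _ ((m : ℝ) ^ _), hone, mul_one]

end Node

/-! ### Convergence of the clockwork dynamic -/

namespace Node
variable {n m : ℕ} {c : Fin n → Fin m}

theorem mem_bestResponses_iff {u : Game n m} {β : Node c → Fin m} (hβ : u ∈ strictBestResponses β)
    (i : Fin n) (s : Fin n → Fin m) (a : Fin m) : a ∈ bestResponses u i s ↔ a = β (of c i s) := by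
  have hpay : ∀ b, u i (Function.update s i b) = payoff u (of c i s) b := fun b => by simp [payoff]
  simp only [bestResponses, Set.mem_ofPred_eq, hpay]
  constructor
  · intro h
    by_contra hne
    exact (h _).not_gt (hβ _ a hne)
  · rintro rfl b
    by_cases hb : b = β (of c i s)
    · rw [hb]
    · exact (hβ _ b hb).le

theorem isPSNE_iff {u : Game n m} {β : Node c → Fin m} (hβ : u ∈ strictBestResponses β)
    (s : Fin n → Fin m) : IsPSNE u s ↔ ∀ i, β (of c i s) = s i := by
  refine forall_congr' fun i => ?_
  rw [eq_comm, ← mem_bestResponses_iff hβ]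
  simp [bestResponses]

variable [NeZero n]

/-- The best responses `β` make `c` an equilibrium, and following them leads from every decision
node to `c`. -/
def Absorbs (β : Node c → Fin m) : Prop :=
  (∀ v : Node c, v.profile = c → β v = c v.player) ∧
    ∀ v : Node c, ∃ k, ((fun v => v.step (β v))^[k] v).profile = c

/-- The player who moves in turn `t`. -/
def turn (n : ℕ) [NeZero n] (t : ℕ) : Fin n := ⟨t % n, Nat.mod_lt _ (NeZero.pos n)⟩

theorem turn_succ (t : ℕ) : turn n (t + 1) = turn n t + 1 := by
  have := Nat.mod_lt t (NeZero.pos n)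
  rw [Fin.ext_iff, fin_val_add_one]
  change (t + 1) % n = if t % n + 1 = n then 0 else t % n + 1
  rw [← Nat.mod_add_mod]
  split_ifs with h
  · rw [h, Nat.mod_self]
  · exact Nat.mod_eq_of_lt (by omega)

theorem isClockworkPlay_iff {u : Game n m} {β : Node c → Fin m} (hβ : u ∈ strictBestResponses β)
    (s : ℕ → Fin n → Fin m) : IsClockworkPlay u s ↔
      ∀ t, s (t + 1) = Function.update (s t) (turn n t) (β (of c (turn n t) (s t))) := by
  refine forall_congr' fun t => ?_
  constructor
  · intro h
    obtain ⟨a, ha, hs⟩ := h (turn n t) rfl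
    rwa [(mem_bestResponses_iff hβ _ _ _).1 ha] at hs
  · intro h i hi
    obtain rfl : i = turn n t := Fin.ext hi
    exact ⟨_, (mem_bestResponses_iff hβ _ _ _).2 rfl, h⟩

theorem of_turn_play {β : Node c → Fin m} {s : ℕ → Fin n → Fin m}
    (hs : ∀ t, s (t + 1) = Function.update (s t) (turn n t) (β (of c (turn n t) (s t))))
    (t k : ℕ) : of c (turn n (t + k)) (s (t + k)) =
      (fun v => v.step (β v))^[k] (of c (turn n t) (s t)) := by
  induction k with
  | zero => rfl
  | succ k ih =>
    rw [Function.iterate_succ_apply', ← ih, ← add_assoc, hs, turn_succ]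
    simp [step]

theorem play_eventually_target {β : Node c → Fin m} (hβ : Absorbs β) {s : ℕ → Fin n → Fin m}
    (hs : ∀ t, s (t + 1) = Function.update (s t) (turn n t) (β (of c (turn n t) (s t)))) :
    ∃ T, ∀ t ≥ T, s t = c := by
  obtain ⟨k, hk⟩ := hβ.2 (of c (turn n 0) (s 0))
  rw [← of_turn_play hs 0 k, zero_add] at hk
  have h1 : s (k + 1) = c := by
    rw [hs, hβ.1 _ hk]
    exact hk
  refine ⟨k + 1, fun t ht => ?_⟩
  induction t, ht using Nat.le_induction with
  | base => exact h1
  | succ t _ ih =>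
    rw [hs, ih, hβ.1 _ (profile_of_target _), player_of, Function.update_eq_self]

theorem isConvergent_of_absorbs {u : Game n m} {β : Node c → Fin m} (hu : u ∈ strictBestResponses β)
    (hβ : Absorbs β) : IsConvergent u ∧ {s | IsPSNE u s} = {c} := by
  refine ⟨fun s hs => ?_, Set.eq_singleton_iff_unique_mem.2 ⟨?_, fun s hs => ?_⟩⟩
  · obtain ⟨T, hT⟩ := play_eventually_target hβ ((isClockworkPlay_iff hu s).1 hs)
    exact ⟨T, fun t ht => by rw [hT t ht, hT (t + 1) (by omega)]⟩
  · exact (isPSNE_iff hu c).2 fun i => hβ.1 _ (profile_of_target i)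
  · have h := (isPSNE_iff hu s).1 hs
    obtain ⟨T, hT⟩ := play_eventually_target hβ (s := fun _ => s) fun t => by
      rw [h, Function.update_eq_self]
    exact hT T le_rfl

/-- After `n - v.player` turns the first player is about to move, as at the start of a play. -/
theorem iterate_step_turn_zero (β : Node c → Fin m) (v : Node c) :
    ((fun v => v.step (β v))^[n - v.player] v).player = turn n 0 := by
  have key : ∀ k, ((fun v => v.step (β v))^[k] v).player = turn n (v.player + k) := by
    intro k
    induction k with
    | zero => exact Fin.ext (Nat.mod_eq_of_lt v.player.isLt).symm
    | succ k ih => rw [Function.iterate_succ_apply', player_step, ih, ← turn_succ, add_assoc]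
  rw [key, Nat.add_sub_cancel' v.player.isLt.le]
  simp [turn]

theorem absorbs_of_isConvergent {u : Game n m} {β : Node c → Fin m} (hu : u ∈ strictBestResponses β)
    (hconv : IsConvergent u) (hc : {s | IsPSNE u s} = {c}) : Absorbs β := by
  have hpsne : IsPSNE u c := by
    have : c ∈ {s | IsPSNE u s} := hc ▸ rfl
    exact this
  have hof : ∀ v : Node c, v.profile = c → of c v.player c = v := fun v hv => by
    conv_rhs => rw [← of_player_profile v, hv]
  refine ⟨fun v hv => ?_, fun v => ?_⟩
  · rw [← (isPSNE_iff hu c).1 hpsne, hof v hv]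
  -- A node need not occur in a play, but the next node of the first player starts one.
  · set φ : Node c → Node c := fun v => v.step (β v)
    set w := φ^[n - v.player] v
    have hw : w.player = turn n 0 := iterate_step_turn_zero β v
    let s : ℕ → Fin n → Fin m := fun t => Nat.rec w.profile
      (fun t s => Function.update s (turn n t) (β (of c (turn n t) s))) t
    have hs : ∀ t, s (t + 1) = Function.update (s t) (turn n t) (β (of c (turn n t) (s t))) :=
      fun t => rfl
    obtain ⟨T, hT⟩ := hconv s ((isClockworkPlay_iff hu s).2 hs)
    have hconst : ∀ t ≥ T, s t = s T := fun t ht => by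
      induction t, ht using Nat.le_induction with
      | base => rfl
      | succ t ht ih => rw [hT t ht, ih]
    have hTc : s T = c := by
      have : s T ∈ {s | IsPSNE u s} := by
        refine (isPSNE_iff hu (s T)).2 fun i => ?_
        -- Player `i` moves in turn `n * T + i`, when the play is already constant.
        have ht : T ≤ n * T + i := by nlinarith [NeZero.pos n]
        have hturn : turn n (n * T + i) = i := by
          refine Fin.ext ?_
          simp [turn, Nat.mod_eq_of_lt i.isLt]
        have h1 := hs (n * T + i)
        rw [hconst _ ht, hconst (n * T + i + 1) (by omega), hturn] at h1
        have h2 := congrFun h1 i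
        rwa [Function.update_self, eq_comm] at h2
      rw [hc] at this
      exact this
    refine ⟨T + (n - v.player), ?_⟩
    rw [Function.iterate_add_apply]
    have h3 := of_turn_play hs 0 T
    have h4 : of c (turn n 0) (s 0) = w := by rw [← hw]; exact of_player_profile w
    rw [h4, zero_add, hTc] at h3
    change (φ^[T] w).profile = c
    rw [← h3, profile_of_target]

open Classical in
/-- The determinant of `card_absorbing_choices_eq_det` has rows scaled by `m`, except for the `n`
nodes of `c`. -/
theorem card_absorbs (hm : 2 ≤ m) (c : Fin n → Fin m) :
    ((Finset.univ.filter fun β : Node c → Fin m => Absorbs β).card : ℝ) * (m : ℝ) ^ n =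
      (m : ℝ) ^ Fintype.card (Node c) * (1 - killedWalk c (m : ℝ)⁻¹).det := by
  have hm0 : (m : ℝ) ≠ 0 := by positivity
  have h1 := card_absorbing_choices_eq_det (fun v : Node c => v.profile = c) step
    fun v => c v.player
  have h2 := Eq.trans (b := ((Finset.univ.filter fun β : Node c → Fin m =>
    (∀ v : Node c, v.profile = c → β v = c v.player) ∧
      ∀ v : Node c, ∃ k, ((fun v : Node c => v.step (β v))^[k] v).profile = c).card : ℝ))
    (a := ((Finset.univ.filter fun β : Node c → Fin m => Absorbs β).card : ℝ))
    (by unfold Absorbs; congr!) h1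
  have h3 : (Matrix.of fun v w : Node c =>
      if v.profile = c then (if w = v then (1 : ℝ) else 0)
      else ∑ a, ((if w = v then 1 else 0) - (if w = v.step a then 1 else 0))) =
      Matrix.diagonal (fun v : Node c => if v.profile = c then (1 : ℝ) else m) *
        (1 - killedWalk c (m : ℝ)⁻¹) := by
    ext v w
    rw [Matrix.diagonal_mul]
    by_cases hv : v.profile = c
    · simp [hv, killedWalk, Matrix.one_apply, eq_comm]
    · simp only [Matrix.of_apply, hv, if_false, killedWalk, Matrix.sub_apply, Matrix.one_apply,
        Finset.sum_sub_distrib, mul_sub, Finset.mul_sum, mul_ite, mul_zero, mul_inv_cancel₀ hm0]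
      simp [eq_comm]
  have h4 : (Finset.univ.filter fun v : Node c => v.profile = c).card = n := by
    have : (Finset.univ.filter fun v : Node c => v.profile = c) =
        Finset.univ.image fun i => of c i c := by
      ext v
      simp only [Finset.mem_filter, Finset.mem_univ, true_and, Finset.mem_image]
      constructor
      · intro hv
        exact ⟨v.player, by conv_rhs => rw [← of_player_profile v, hv]⟩
      · rintro ⟨i, rfl⟩
        exact profile_of_target i
    rw [this, Finset.card_image_of_injective _ fun i j h => by simpa using congrArg player h,
      Finset.card_univ, Fintype.card_fin]
  have h5 : (∏ v : Node c, if v.profile = c then (1 : ℝ) else m) * (m : ℝ) ^ n =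
      (m : ℝ) ^ Fintype.card (Node c) := by
    have h6 : (m : ℝ) ^ n = ∏ v : Node c, if v.profile = c then (m : ℝ) else 1 := by
      rw [← Finset.prod_filter, Finset.prod_const, h4]
    rw [h6, ← Finset.card_univ, ← Finset.prod_const, ← Finset.prod_mul_distrib]
    refine Finset.prod_congr rfl fun v _ => ?_
    split_ifs <;> simp
  rw [h2, h3, Matrix.det_mul, Matrix.det_diagonal, mul_right_comm, h5]

end Node

/-! ### The probability of convergence to a unique equilibrium -/

open Classical in
theorem convergentFrequency_one_eq_sum (n m : ℕ) [NeZero n] (hm : 0 < m) :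
    convergentFrequency 1 n m = ∑ c : Fin n → Fin m,
      ((Finset.univ.filter fun β : Node c → Fin m => Node.Absorbs β).card : ℝ) /
        (m : ℝ) ^ Fintype.card (Node c) := by
  set H : (Fin n → Fin m) → Set (Game n m) := fun c =>
    ⋃ β ∈ Finset.univ.filter fun β : Node c → Fin m => Node.Absorbs β, Node.strictBestResponses β
    with hH
  have hmem : ∀ c u, u ∈ H c → IsConvergent u ∧ {s | IsPSNE u s} = {c} := by
    intro c u hu
    obtain ⟨β, hβ, hu⟩ := Set.mem_iUnion₂.1 hu
    exact Node.isConvergent_of_absorbs hu (Finset.mem_filter.1 hβ).2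
  have hcongr : {u : Game n m | IsConvergent u ∧ {s | IsPSNE u s}.ncard = 1} =ᵐ[randomGame n m]
      ⋃ c ∈ (Finset.univ : Finset (Fin n → Fin m)), H c := by
    filter_upwards [ae_randomGame_payoff_ne n m] with u hu
    refine propext ⟨fun h => ?_, fun h => ?_⟩
    · obtain ⟨hconv, hcard⟩ : IsConvergent u ∧ {s | IsPSNE u s}.ncard = 1 := h
      obtain ⟨c, hc⟩ := Set.ncard_eq_one.1 hcard
      obtain ⟨β, hβ⟩ := Node.exists_mem_strictBestResponses (c := c) hm hu
      exact Set.mem_iUnion₂.2 ⟨c, Finset.mem_univ c, Set.mem_iUnion₂.2 ⟨β, Finset.mem_filter.2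
        ⟨Finset.mem_univ β, Node.absorbs_of_isConvergent hβ hconv hc⟩, hβ⟩⟩
    · obtain ⟨c, -, hc⟩ := Set.mem_iUnion₂.1 h
      obtain ⟨hconv, hc⟩ := hmem c u hc
      exact ⟨hconv, by rw [hc, Set.ncard_singleton]⟩
  rw [convergentFrequency, measureReal_congr hcongr,
    measureReal_biUnion_finset _ _ fun _ _ => measure_ne_top _ _]
  · exact Finset.sum_congr rfl fun c _ => Node.measureReal_biUnion_strictBestResponses hm _
  · intro c _ c' _ hne
    refine Set.disjoint_left.2 fun u h h' => hne ?_
    exact Set.singleton_injective ((hmem c u h).2.symm.trans (hmem c' u h').2)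
  · exact fun c _ => Finset.measurableSet_biUnion _ fun β _ =>
      Node.measurableSet_strictBestResponses β

open Classical in
/-- The probability is `(r ^ n - 1) / (1 - m⁻¹ ^ n)`. -/
theorem convergentFrequency_one_mul (n m : ℕ) (hn : 2 ≤ n) (hm : 2 ≤ m) :
    (1 - (m : ℝ)⁻¹ ^ n) * convergentFrequency 1 n m =
      (1 + (1 - (m : ℝ)⁻¹) * (m : ℝ)⁻¹ ^ (n - 1)) ^ n - 1 := by
  have : NeZero n := ⟨by omega⟩
  have hm0 : (m : ℝ) ≠ 0 := by positivity
  have hdet := fun c : Fin n → Fin m =>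
    Node.det_one_sub_killedWalk hn (inv_mul_cancel₀ hm0) hm c
  rw [convergentFrequency_one_eq_sum n m (by omega), Finset.mul_sum]
  have hterm : ∀ c : Fin n → Fin m, (1 - (m : ℝ)⁻¹ ^ n) *
      (((Finset.univ.filter fun β : Node c → Fin m => Node.Absorbs β).card : ℝ) /
        (m : ℝ) ^ Fintype.card (Node c)) =
      ((1 + (1 - (m : ℝ)⁻¹) * (m : ℝ)⁻¹ ^ (n - 1)) ^ n - 1) / (m : ℝ) ^ n := by
    intro c
    rw [← hdet c, mul_div_assoc]
    congr 1
    rw [div_eq_div_iff (by positivity) (by positivity), Node.card_absorbs hm c, mul_comm]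
  rw [Finset.sum_congr rfl fun c _ => hterm c, Finset.sum_const, Finset.card_univ, Fintype.card_fun,
    Fintype.card_fin, Fintype.card_fin, nsmul_eq_mul]
  push_cast
  exact mul_div_cancel₀ _ (by positivity)

theorem convergentFrequency_one_eq (n m : ℕ) (hn : 2 ≤ n) (hm : 2 ≤ m) (r : ℝ)
    (hr : r = ((m : ℝ) - 1) / (m : ℝ) ^ n + 1) : convergentFrequency 1 n m =
      r ^ (n - 1) + ((m : ℝ) - 1) / ((m : ℝ) - r) * ((r / (m : ℝ)) ^ (n - 1) - 1) := by
  have h := convergentFrequency_one_mul n m hn hm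
  obtain ⟨k, rfl⟩ : ∃ k, n = k + 1 := ⟨n - 1, by omega⟩
  have hm1 : (1 : ℝ) < m := by exact_mod_cast hm
  have hm0 : (m : ℝ) ≠ 0 := by positivity
  have hpow : (1 : ℝ) < (m : ℝ) ^ (k + 1) := one_lt_pow₀ hm1 (by omega)
  rw [Nat.add_sub_cancel] at *
  have hr' : 1 + (1 - (m : ℝ)⁻¹) * (m : ℝ)⁻¹ ^ k = r := by
    rw [hr, pow_succ, inv_pow]; field_simp; ring
  rw [hr'] at h
  have hq : 1 - (m : ℝ)⁻¹ ^ (k + 1) ≠ 0 := by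
    rw [inv_pow]
    exact (sub_pos.2 (inv_lt_one_of_one_lt₀ hpow)).ne'
  have hmr : (m : ℝ) - r = (m - 1) * (1 - (m : ℝ)⁻¹ ^ (k + 1)) := by
    rw [hr, inv_pow]; field_simp; ring
  have hm1' : (m : ℝ) - 1 ≠ 0 := by linarith
  refine mul_left_cancel₀ hq (h.trans ?_)
  rw [hmr, div_mul_eq_div_div, div_self hm1', mul_add, ← mul_assoc, mul_one_div_cancel hq, one_mul,
    div_eq_mul_inv r, mul_pow]
  nth_rewrite 1 [pow_succ r k]
  have : r = 1 + (1 - (m : ℝ)⁻¹) * (m : ℝ)⁻¹ ^ k := hr'.symm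
  have h3 : (m : ℝ)⁻¹ ^ (k + 1) = (m : ℝ)⁻¹ ^ k * (m : ℝ)⁻¹ := pow_succ _ _
  rw [h3]
  linear_combination r ^ k * this

theorem theorem1 (n m : ℕ) (hn : 2 ≤ n) (hm : 2 ≤ m) (r : ℝ)
    (hr : r = ((m : ℝ) - 1) / (m : ℝ) ^ n + 1) :
    convergentFrequency 1 n m =
        r ^ (n - 1) + ((m : ℝ) - 1) / ((m : ℝ) - r) * ((r / (m : ℝ)) ^ (n - 1) - 1) ∧
      convergentFrequency 1 2 m = (2 * (m : ℝ) - 1) / (m : ℝ) ^ 2 := by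
  refine ⟨convergentFrequency_one_eq n m hn hm r hr, ?_⟩
  have h := convergentFrequency_one_mul 2 m le_rfl hm
  have hm1 : (1 : ℝ) < m := by exact_mod_cast hm
  have hm0 : (m : ℝ) ≠ 0 := by positivity
  have hq : 1 - (m : ℝ)⁻¹ ^ 2 ≠ 0 := by
    rw [inv_pow]
    exact (sub_pos.2 (inv_lt_one_of_one_lt₀ (one_lt_pow₀ hm1 two_ne_zero))).ne'
  refine mul_left_cancel₀ hq (h.trans ?_)
  rw [show 2 - 1 = 1 from rfl, pow_one, inv_pow]
  field_simp
  ring
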